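/- Let $n\ge 3$ be an integer. The following inequalities hold. (1) For all integers $0\le k\le\left\lceil\frac{n-1}{3}\right\rceil$, $$\sum_{j=0}^k(-1)^{k-j}\binom{\left\lceil\frac{n-1}{3}\right\rceil-j}{k-j}\binom{n-j+1}{j}\;\ge\;\sum_{j=2}^k(-1)^{k-j}\binom{\left\lceil\frac{n-1}{3}\right\rceil-j}{k-j}\binom{n-j+1}{j-2}.$$ (2) For all integers $2\le k\le\left\lceil\frac{n+2}{3}\right\rceil$, $$\sum_{j=2}^k(-1)^{k-j}\binom{\left\lceil\frac{n+2}{3}\right\rceil-j}{k-j}\binom{n-j+1}{j-2}\;\ge\;0.$$ (3) For all integers $0\le k\le\left\lceil\frac{n+2}{3}\right\rceil$, $$\binom{\left\lfloor\frac{2n+1}{3}\right\rfloor+k-2}{k}-\sum_{j=0}^k(-1)^{k-j}\binom{\left\lceil\frac{n+2}{3}\right\rceil-j}{k-j}\binom{n-j+1}{j}\;\ge\;\sum_{j=2}^k(-1)^{k-j}\binom{\left\lceil\frac{n+2}{3}\right\rceil-j}{k-j}\binom{n-j+1}{j-2}.$$ Moreover, the following inequalities (the case $m=2$ of the corresponding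 inequalities for the $m$-path ideal of a cycle graph on $n$ vertices) hold. (1') For all integers $0\le k\le\left\lceil\frac{n-1}{3}\right\rceil$, $$\sum_{j=0}^k(-1)^{k-j}\binom{\left\lceil\frac{n-1}{3}\right\rceil-j}{k-j}\binom{n-j+1}{j}\;\ge\;\sum_{j=2}^k(-1)^{k-j}\binom{\left\lceil\frac{n-1}{3}\right\rceil-j}{k-j}\binom{n-j-1}{j-2}.$$ (2') For all integers $2\le k\le\left\lceil\frac{n+2}{3}\right\rceil$, $$\sum_{j=2}^k(-1)^{k-j}\binom{\left\lceil\frac{n+2}{3}\right\rceil-j}{k-j}\binom{n-j-1}{j-2}\;\ge\;0.$$ (3') For all integers $0\le k\le\left\lceil\frac{n+2}{3}\right\rceil$, $$\binom{\left\lfloor\frac{2n+1}{3}\right\rfloor+k-2}{k}-\sum_{j=0}^k(-1)^{k-j}\binom{\left\lceil\frac{n+2}{3}\right\rceil-j}{k-j}\binom{n-j+1}{j}\;\ge\;-\sum_{j=2}^k(-1)^{k-j}\binom{\left\lceil\frac{n+2}{3}\right\rceil-j}{k-j}\binom{n-j-1}{j-2}.$$ -/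

import Mathlib

open PowerSeries

/-! Put y = X / (1 - X). Since (1 - X)^d y^j = X^j (1 - X)^(d-j), each alternating sum is the
coefficient of X^k in (1 - X)^d P(y), where P has the plain binomials as coefficients. These P are
F_(n+2), y^2 F_n and y^2 F_(n-2), with F the Fibonacci polynomials F_(i+2) = F_(i+1) + y F_i.

The engine is F_(i+3) = (1 + y) F_(i+1) + y F_i. Multiplied by 1 - X, the right side becomes F_(i+1)
+ X F_i, so a factor 1 - X is paid for by three index steps; this explains the thirds in the
statement. It gives (2), (2') directly (`coeffNonneg_one_sub_X_pow_mul_fibSeries`). For (3) it is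
applied to (1 + y)^n - F_(n+2) - y^2 F_n, which obeys the recursion up to a nonnegative term.

For (1), F_(n+2) - y^2 F_n obeys the recursion too, but only coefficients with k ≤ d are
nonnegative. The recursion handles k < d; the diagonal k = d needs the exact value 1 in the extremal
case (`topCoeff_three_mul_add_two`). -/

/-! ### Powers of X / (1 - X) and their coefficients. -/

/-- The power series `X / (1 - X)`. -/
noncomputable def geomTail : ℤ⟦X⟧ := X * PowerSeries.mk 1

theorem one_sub_X_mul_geomTail : (1 - X) * geomTail = X := by
  have h := PowerSeries.mk_one_mul_one_sub_eq_one ℤ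
  unfold geomTail
  linear_combination (X : ℤ⟦X⟧) * h

theorem one_sub_X_mul_one_add_geomTail : (1 - X) * (1 + geomTail) = 1 := by
  linear_combination one_sub_X_mul_geomTail

theorem one_add_geomTail_eq_mk : 1 + geomTail = PowerSeries.mk 1 := by
  have h := PowerSeries.mk_one_mul_one_sub_eq_one ℤ
  linear_combination (PowerSeries.mk 1 : ℤ⟦X⟧) * one_sub_X_mul_one_add_geomTail
    - (1 + geomTail) * h

theorem one_sub_X_pow_mul_geomTail_pow {d j : ℕ} (h : j ≤ d) :
    (1 - X) ^ d * geomTail ^ j = X ^ j * (1 - X) ^ (d - j) := by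
  obtain ⟨e, rfl⟩ := Nat.exists_eq_add_of_le h
  rw [Nat.add_sub_cancel_left, pow_add, mul_right_comm, ← mul_pow, one_sub_X_mul_geomTail]

theorem one_sub_X_pow_mul_one_add_geomTail_pow {d m : ℕ} (h : d ≤ m) :
    (1 - X) ^ d * (1 + geomTail) ^ m = (1 + geomTail) ^ (m - d) := by
  obtain ⟨e, rfl⟩ := Nat.exists_eq_add_of_le h
  rw [Nat.add_sub_cancel_left, pow_add, ← mul_assoc, ← mul_pow, one_sub_X_mul_one_add_geomTail,
    one_pow, one_mul]

theorem coeff_one_sub_X_pow (m k : ℕ) :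
    coeff k ((1 - X : ℤ⟦X⟧) ^ m) = (-1) ^ k * (m.choose k : ℤ) := by
  induction m generalizing k with
  | zero => cases k <;> simp [coeff_one]
  | succ m ih =>
    rw [pow_succ, mul_sub, mul_one, map_sub, ih]
    cases k with
    | zero => simp
    | succ k =>
      rw [coeff_succ_mul_X, ih, Nat.choose_succ_succ]
      push_cast
      ring

theorem coeff_one_sub_X_pow_mul_geomTail_pow {d k : ℕ} (hk : k ≤ d) (j : ℕ) :
    coeff k ((1 - X) ^ d * geomTail ^ j) =
      if j ≤ k then (-1) ^ (k - j) * ((d - j).choose (k - j) : ℤ) else 0 := by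
  split_ifs with h
  · rw [one_sub_X_pow_mul_geomTail_pow (h.trans hk), coeff_X_pow_mul', if_pos h,
      coeff_one_sub_X_pow]
  · rw [geomTail, mul_pow, mul_left_comm, coeff_X_pow_mul', if_neg h]

/-! ### Coefficientwise nonnegativity. -/

/-- A power series with nonnegative coefficients. -/
def CoeffNonneg (φ : ℤ⟦X⟧) : Prop := ∀ k, 0 ≤ coeff k φ

namespace CoeffNonneg

theorem add {φ ψ : ℤ⟦X⟧} (hφ : CoeffNonneg φ) (hψ : CoeffNonneg ψ) : CoeffNonneg (φ + ψ) :=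
  fun k => by rw [map_add]; exact add_nonneg (hφ k) (hψ k)

theorem mul {φ ψ : ℤ⟦X⟧} (hφ : CoeffNonneg φ) (hψ : CoeffNonneg ψ) : CoeffNonneg (φ * ψ) :=
  fun k => by
    rw [coeff_mul]
    exact Finset.sum_nonneg fun p _ => mul_nonneg (hφ p.1) (hψ p.2)

theorem zero : CoeffNonneg 0 := fun k => by simp

theorem one : CoeffNonneg 1 := fun k => by
  rw [coeff_one]
  split_ifs <;> norm_num

theorem pow {φ : ℤ⟦X⟧} (hφ : CoeffNonneg φ) (m : ℕ) : CoeffNonneg (φ ^ m) := by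
  induction m with
  | zero => rw [pow_zero]; exact one
  | succ m ih => rw [pow_succ]; exact ih.mul hφ

theorem X : CoeffNonneg X := fun k => by
  rw [coeff_X]
  split_ifs <;> norm_num

theorem mk_one : CoeffNonneg (PowerSeries.mk 1) := fun k => by simp

theorem geomTail : CoeffNonneg geomTail := X.mul mk_one

theorem one_add_geomTail : CoeffNonneg (1 + _root_.geomTail) := one.add geomTail

theorem of_one_sub_X_mul {φ : ℤ⟦X⟧} (h : CoeffNonneg ((1 - PowerSeries.X) * φ)) :
    CoeffNonneg φ := by
  have := one_add_geomTail.mul h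
  rwa [← mul_assoc, mul_comm (1 + _root_.geomTail), one_sub_X_mul_one_add_geomTail,
    one_mul] at this

end CoeffNonneg

/-! ### Fibonacci polynomials and the alternating sums. -/

/-- The Fibonacci polynomials, evaluated at `X / (1 - X)`. -/
noncomputable def fibSeries : ℕ → ℤ⟦X⟧
  | 0 => 0
  | 1 => 1
  | i + 2 => fibSeries (i + 1) + geomTail * fibSeries i

theorem fibSeries_add_two (i : ℕ) :
    fibSeries (i + 2) = fibSeries (i + 1) + geomTail * fibSeries i := by
  rw [fibSeries]

theorem fibSeries_add_three (i : ℕ) :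
    fibSeries (i + 3) = (1 + geomTail) * fibSeries (i + 1) + geomTail * fibSeries i := by
  rw [fibSeries_add_two (i + 1), fibSeries_add_two i]
  ring

theorem fibSeries_succ_eq_sum {i N : ℕ} (h : i < N) :
    fibSeries (i + 1) =
      ∑ j ∈ Finset.range N, ((i - j).choose j : ℤ⟦X⟧) * geomTail ^ j := by
  induction i using Nat.twoStepInduction generalizing N with
  | zero =>
    obtain ⟨N, rfl⟩ := Nat.exists_eq_succ_of_ne_zero h.ne'
    simp [Finset.sum_range_succ', fibSeries]
  | one =>
    obtain ⟨N, rfl⟩ := Nat.exists_eq_succ_of_ne_zero (Nat.ne_of_gt (Nat.zero_lt_of_lt h))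
    simp [Finset.sum_range_succ', fibSeries]
  | more i ih₁ ih₂ =>
    obtain ⟨N, rfl⟩ := Nat.exists_eq_succ_of_ne_zero (Nat.ne_of_gt (Nat.zero_lt_of_lt h))
    rw [fibSeries_add_two, ih₁ (show i < N by omega), ih₂ (show i + 1 < N + 1 by omega),
      Finset.sum_range_succ', Finset.sum_range_succ', Finset.mul_sum, add_right_comm,
      ← Finset.sum_add_distrib]
    congr 1
    · refine Finset.sum_congr rfl fun j _ => ?_
      have key : (i + 2 - (j + 1)).choose (j + 1) =
          (i + 1 - (j + 1)).choose (j + 1) + (i - j).choose j := by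
        rcases le_or_gt j i with hj | hj
        · rw [show i + 2 - (j + 1) = (i - j) + 1 by omega,
            show i + 1 - (j + 1) = i - j by omega, Nat.choose_succ_succ, add_comm]
        · rw [Nat.choose_eq_zero_of_lt (by omega), Nat.choose_eq_zero_of_lt (by omega),
            Nat.choose_eq_zero_of_lt (by omega)]
      rw [key]
      push_cast
      ring

theorem coeff_one_sub_X_pow_mul_fibSeries {d k : ℕ} (hk : k ≤ d) (i : ℕ) :
    coeff k ((1 - X) ^ d * fibSeries (i + 1)) =
      ∑ j ∈ Finset.Icc 0 k, (-1 : ℤ) ^ (k - j) * ((d - j).choose (k - j) : ℤ) *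
        ((i - j).choose j : ℤ) := by
  -- The bound `i + k + 1` exceeds both `i` and `k`: the expansion is complete, and filtering by `j
  -- ≤ k` leaves exactly `Icc 0 k`.
  rw [fibSeries_succ_eq_sum (show i < i + k + 1 by omega), Finset.mul_sum, map_sum]
  have hterm : ∀ j, coeff k ((1 - X) ^ d * (((i - j).choose j : ℤ⟦X⟧) * geomTail ^ j)) =
      if j ≤ k then (-1 : ℤ) ^ (k - j) * ((d - j).choose (k - j) : ℤ) *
        ((i - j).choose j : ℤ) else 0 := fun j => by
    rw [mul_left_comm, ← map_natCast (PowerSeries.C (R := ℤ)), coeff_C_mul,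
      coeff_one_sub_X_pow_mul_geomTail_pow hk]
    split_ifs <;> ring
  rw [Finset.sum_congr rfl fun j _ => hterm j, ← Finset.sum_filter]
  refine Finset.sum_congr ?_ fun _ _ => rfl
  ext j
  simp only [Finset.mem_filter, Finset.mem_range, Finset.mem_Icc]
  omega

theorem coeff_one_sub_X_pow_mul_sq_mul (d k : ℕ) (φ : ℤ⟦X⟧) :
    coeff (k + 2) ((1 - X) ^ (d + 2) * (geomTail ^ 2 * φ)) = coeff k ((1 - X) ^ d * φ) := by
  rw [← mul_assoc, one_sub_X_pow_mul_geomTail_pow (Nat.le_add_left 2 d), mul_assoc,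
    coeff_X_pow_mul, Nat.add_sub_cancel]

theorem coeff_mul_sq_mul_of_lt {k : ℕ} (hk : k < 2) (φ ψ : ℤ⟦X⟧) :
    coeff k (φ * (geomTail ^ 2 * ψ)) = 0 := by
  rw [geomTail, mul_pow, mul_assoc, mul_left_comm, coeff_X_pow_mul', if_neg (by omega)]

theorem coeff_one_sub_X_pow_mul_sq_mul_fibSeries {d k : ℕ} (hk : k ≤ d) (i : ℕ) :
    coeff k ((1 - X) ^ d * (geomTail ^ 2 * fibSeries (i + 1))) =
      ∑ j ∈ Finset.Icc 2 k, (-1 : ℤ) ^ (k - j) * ((d - j).choose (k - j) : ℤ) *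
        ((i - (j - 2)).choose (j - 2) : ℤ) := by
  rcases lt_or_ge k 2 with h2 | h2
  · rw [coeff_mul_sq_mul_of_lt h2, Finset.Icc_eq_empty (by omega), Finset.sum_empty]
  · obtain ⟨k, rfl⟩ := Nat.exists_eq_add_of_le' h2
    obtain ⟨d, rfl⟩ := Nat.exists_eq_add_of_le' (h2.trans hk)
    rw [coeff_one_sub_X_pow_mul_sq_mul,
      coeff_one_sub_X_pow_mul_fibSeries (Nat.le_of_add_le_add_right hk)]
    refine Finset.sum_bij' (fun j _ => j + 2) (fun j _ => j - 2) ?_ ?_ ?_ ?_ ?_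
    · intro j hj
      simp only [Finset.mem_Icc] at hj ⊢
      omega
    · intro j hj
      simp only [Finset.mem_Icc] at hj ⊢
      omega
    · intro j _
      omega
    · intro j hj
      simp only [Finset.mem_Icc] at hj
      omega
    · intro j _
      simp only [Nat.add_sub_add_right, Nat.add_sub_cancel]

theorem coeffNonneg_fibSeries (i : ℕ) : CoeffNonneg (fibSeries i) := by
  induction i using Nat.twoStepInduction with
  | zero => exact CoeffNonneg.zero
  | one => exact CoeffNonneg.one
  | more i ih₁ ih₂ =>
    rw [fibSeries_add_two]
    exact ih₂.add (CoeffNonneg.geomTail.mul ih₁)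

/-- Multiplying the three-step recursion of the Fibonacci polynomials by `1 - X` leaves a
recursion with nonnegative coefficients. -/
theorem one_sub_X_pow_succ_mul_recursion (d : ℕ) (φ ψ : ℤ⟦X⟧) :
    (1 - X) ^ (d + 1) * ((1 + geomTail) * φ + geomTail * ψ) =
      (1 - X) ^ d * φ + X * ((1 - X) ^ d * ψ) := by
  linear_combination (1 - X) ^ d * φ * one_sub_X_mul_one_add_geomTail
    + (1 - X) ^ d * ψ * one_sub_X_mul_geomTail

/-- Each factor `1 - X` is absorbed by one use of the three-step recursion. -/
theorem coeffNonneg_one_sub_X_pow_mul_fibSeries (d : ℕ) {i : ℕ} (h : 3 * d ≤ i) :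
    CoeffNonneg ((1 - X) ^ d * fibSeries i) := by
  induction d generalizing i with
  | zero => simpa using coeffNonneg_fibSeries i
  | succ d ih =>
    obtain ⟨i, rfl⟩ : ∃ e, i = e + 3 := ⟨i - 3, by omega⟩
    rw [fibSeries_add_three, one_sub_X_pow_succ_mul_recursion]
    exact (ih (by omega)).add (CoeffNonneg.X.mul (ih (by omega)))

/-! ### Inequality (3): the complement series. -/

/-- The difference between `(1 - X) ^ (-n)` and the series of the path and cycle counts. -/
noncomputable def complementSeries (n : ℕ) : ℤ⟦X⟧ :=
  (1 + geomTail) ^ n - fibSeries (n + 2) - geomTail ^ 2 * fibSeries n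

/-- The inhomogeneous term comes from (1 + y)^3 - (1 + y)^2 - y = y^2 (2 + y). -/
theorem complementSeries_add_three (n : ℕ) :
    complementSeries (n + 3) =
      (1 + geomTail) * complementSeries (n + 1) + geomTail * complementSeries n +
        geomTail * (geomTail * (1 + 1 + geomTail)) * (1 + geomTail) ^ n := by
  simp only [complementSeries]
  rw [show n + 3 + 2 = n + 2 + 3 by ring, fibSeries_add_three (n + 2), fibSeries_add_three n,
    show n + 1 + 2 = n + 2 + 1 by ring]
  ring

theorem coeffNonneg_one_sub_X_pow_mul_complementSeries {n d : ℕ} (hn : 2 ≤ n)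
    (h : 3 * d ≤ n + 4) : CoeffNonneg ((1 - X) ^ d * complementSeries n) := by
  induction n using Nat.strong_induction_on generalizing d with
  | _ n ih =>
    have hsq : ∀ {e : ℕ}, e ≤ 2 → CoeffNonneg ((1 - X) ^ e * geomTail ^ 2) := fun {e} he => by
      have h2 : (1 - X) ^ e * geomTail ^ 2 = X ^ e * geomTail ^ (2 - e) := by
        rw [← Nat.sub_add_cancel he, pow_add, mul_left_comm, ← mul_pow,
          one_sub_X_mul_geomTail, mul_comm, Nat.sub_add_cancel he]
      rw [h2]
      exact (CoeffNonneg.X.pow _).mul (CoeffNonneg.geomTail.pow _)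
    have hsucc : ∀ e, 3 * (e + 1) ≤ n + 4 →
        CoeffNonneg ((1 - X) ^ (e + 1) * complementSeries n) := fun e he => by
      rcases Nat.lt_or_ge n 5 with h5 | h5
      -- For n ≤ 4 at most two factors `1 - X` occur, and `geomTail ^ 2` absorbs them.
      · have he2 : e + 1 ≤ 2 := by omega
        interval_cases n
        · have : complementSeries 2 = 0 := by
            simp only [complementSeries, fibSeries]
            ring
          rw [this, mul_zero]
          exact CoeffNonneg.zero
        · have : complementSeries 3 = geomTail ^ 2 := by
            simp only [complementSeries, fibSeries]
            ring
          rw [this]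
          exact hsq he2
        · have : complementSeries 4 =
              geomTail ^ 2 * (1 + 1 + (1 + 1) * geomTail + geomTail ^ 2) := by
            simp only [complementSeries, fibSeries]
            ring
          rw [this, ← mul_assoc]
          have h11 := CoeffNonneg.one.add CoeffNonneg.one
          exact (hsq he2).mul ((h11.add (h11.mul CoeffNonneg.geomTail)).add
            (CoeffNonneg.geomTail.pow 2))
      · obtain ⟨n, rfl⟩ : ∃ e, n = e + 3 := ⟨n - 3, by omega⟩
        rw [complementSeries_add_three, mul_add, one_sub_X_pow_succ_mul_recursion]
        refine ((ih _ (by omega) (by omega) (by omega)).add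
          (CoeffNonneg.X.mul (ih _ (by omega) (by omega) (by omega)))).add ?_
        have : (1 - X) ^ (e + 1) *
            (geomTail * (geomTail * (1 + 1 + geomTail)) * (1 + geomTail) ^ n) =
            X * (geomTail * (1 + 1 + geomTail)) * (1 + geomTail) ^ (n - e) := by
          rw [← one_sub_X_pow_mul_one_add_geomTail_pow (show e ≤ n by omega)]
          linear_combination geomTail * (1 + 1 + geomTail) * (1 - X) ^ e *
            (1 + geomTail) ^ n * one_sub_X_mul_geomTail
        rw [this]
        exact (CoeffNonneg.X.mul (CoeffNonneg.geomTail.mul ((CoeffNonneg.one.add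
          CoeffNonneg.one).add CoeffNonneg.geomTail))).mul
          (CoeffNonneg.one_add_geomTail.pow _)
    cases d with
    -- The case d = 0 follows from d = 1 on dividing by `1 - X`.
    | zero =>
      rw [pow_zero, one_mul]
      have := hsucc 0 (by omega)
      rw [zero_add, pow_one] at this
      exact this.of_one_sub_X_mul
    | succ d => exact hsucc d h

theorem coeff_one_sub_X_pow_mul_one_add_geomTail_pow {d n : ℕ} (h : d < n) (k : ℕ) :
    coeff k ((1 - X) ^ d * (1 + geomTail) ^ n) = ((n - d - 1 + k).choose k : ℤ) := by
  rw [one_sub_X_pow_mul_one_add_geomTail_pow h.le, one_add_geomTail_eq_mk]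
  obtain ⟨e, he⟩ : ∃ e, n - d = e + 1 := ⟨n - d - 1, by omega⟩
  rw [he, PowerSeries.mk_one_pow_eq_mk_choose_add, coeff_mk, Nat.add_sub_cancel,
    Nat.choose_symm_add]

/-! ### Inequality (1): the difference series and its diagonal coefficients. -/

/-- The difference of the series of the path and cycle counts. -/
noncomputable def differenceSeries (n : ℕ) : ℤ⟦X⟧ :=
  fibSeries (n + 2) - geomTail ^ 2 * fibSeries n

theorem differenceSeries_add_two (n : ℕ) :
    differenceSeries (n + 2) = differenceSeries (n + 1) + geomTail * differenceSeries n := by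
  simp only [differenceSeries]
  rw [fibSeries_add_two (n + 2), fibSeries_add_two n, show n + 1 + 2 = n + 2 + 1 by ring]
  ring

theorem differenceSeries_add_three (n : ℕ) :
    differenceSeries (n + 3) =
      (1 + geomTail) * differenceSeries (n + 1) + geomTail * differenceSeries n := by
  rw [differenceSeries_add_two (n + 1), differenceSeries_add_two n]
  ring

/-- The coefficient of `X ^ d` in `(1 - X) ^ d * differenceSeries n`. -/
noncomputable def topCoeff (n d : ℕ) : ℤ := coeff d ((1 - X) ^ d * differenceSeries n)

theorem topCoeff_add_two (n d : ℕ) :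
    topCoeff (n + 2) (d + 1) = topCoeff (n + 1) (d + 1) + topCoeff n d := by
  simp only [topCoeff]
  rw [differenceSeries_add_two, mul_add, map_add]
  congr 1
  rw [show (1 - X) ^ (d + 1) * (geomTail * differenceSeries n) =
      (1 - X) ^ d * differenceSeries n * X by
    linear_combination (1 - X) ^ d * differenceSeries n * one_sub_X_mul_geomTail,
    coeff_succ_mul_X]

/-- On the diagonal k = d every `(d - j).choose (k - j)` is 1, so consecutive alternating sums
cancel except for the last term. -/
theorem topCoeff_fibSeries_succ (i d : ℕ) :
    coeff (d + 1) ((1 - X) ^ (d + 1) * fibSeries (i + 1)) +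
      coeff d ((1 - X) ^ d * fibSeries (i + 1)) = ((i - (d + 1)).choose (d + 1) : ℤ) := by
  rw [coeff_one_sub_X_pow_mul_fibSeries le_rfl, coeff_one_sub_X_pow_mul_fibSeries le_rfl,
    Finset.sum_Icc_succ_top (Nat.zero_le _), add_right_comm, ← Finset.sum_add_distrib]
  rw [Finset.sum_eq_zero, Nat.sub_self, pow_zero, Nat.choose_zero_right]
  · simp
  · intro j hj
    rw [Finset.mem_Icc] at hj
    rw [Nat.succ_sub hj.2, Nat.choose_self, Nat.choose_self, pow_succ]
    ring

theorem topCoeff_zero (n : ℕ) : topCoeff n 0 = 1 := by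
  rw [topCoeff, differenceSeries, mul_sub, map_sub, coeff_mul_sq_mul_of_lt (by norm_num),
    coeff_one_sub_X_pow_mul_fibSeries le_rfl]
  simp

theorem topCoeff_one (n : ℕ) : topCoeff n 1 = n - 1 := by
  have h := topCoeff_fibSeries_succ (n + 1) 0
  have h0 := topCoeff_zero n
  rw [topCoeff, differenceSeries, mul_sub, map_sub, coeff_mul_sq_mul_of_lt (by norm_num)] at h0 ⊢
  simp only [zero_add, Nat.add_sub_cancel, Nat.choose_one_right] at h
  linarith

theorem topCoeff_add_topCoeff (n d : ℕ) :
    topCoeff (n + 1) (d + 3) + topCoeff (n + 1) (d + 2) =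
      ((n + 2 - (d + 3)).choose (d + 3) : ℤ) - ((n - (d + 1)).choose (d + 1) : ℤ) := by
  have h₁ := topCoeff_fibSeries_succ (n + 2) (d + 2)
  have h₂ := topCoeff_fibSeries_succ n d
  simp only [topCoeff, differenceSeries, mul_sub, map_sub]
  rw [show d + 3 = (d + 1) + 2 by ring, coeff_one_sub_X_pow_mul_sq_mul,
    coeff_one_sub_X_pow_mul_sq_mul, ← h₂]
  have h₁' : coeff (d + 1 + 2) ((1 - X) ^ (d + 1 + 2) * fibSeries (n + 1 + 2)) +
      coeff (d + 2) ((1 - X) ^ (d + 2) * fibSeries (n + 1 + 2)) =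
      ((n + 2 - (d + 1 + 2)).choose (d + 1 + 2) : ℤ) := h₁
  rw [← h₁']
  ring

theorem topCoeff_two (n : ℕ) :
    topCoeff (n + 1) 2 + topCoeff (n + 1) 1 = (n.choose 2 : ℤ) - 1 := by
  have h₁ := topCoeff_fibSeries_succ (n + 2) 1
  have h₂ := coeff_one_sub_X_pow_mul_fibSeries (le_refl 0) n
  simp only [topCoeff, differenceSeries, mul_sub, map_sub]
  rw [coeff_one_sub_X_pow_mul_sq_mul 0 0, h₂, coeff_mul_sq_mul_of_lt (by norm_num)]
  have h₁' : coeff 2 ((1 - X) ^ 2 * fibSeries (n + 1 + 2)) +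
      coeff 1 ((1 - X) ^ 1 * fibSeries (n + 1 + 2)) = (n.choose 2 : ℤ) := h₁
  rw [← h₁']
  simp
  ring

/-- This is the extremal case 3d = n + 1, where no slack remains. Combining `e₁`, `e₂` and `sums`
shows that the value does not change with `m`. -/
theorem topCoeff_three_mul_add_two (m : ℕ) : topCoeff (3 * m + 2) (m + 1) = 1 := by
  induction m with
  | zero => rw [topCoeff_one]; norm_num
  | succ m ih =>
    have e₁ := topCoeff_add_two (3 * m + 3) (m + 1)
    have e₂ := topCoeff_add_two (3 * m + 2) m
    have sums : topCoeff (3 * m + 4) (m + 2) + topCoeff (3 * m + 4) (m + 1) =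
        topCoeff (3 * m + 2) (m + 1) + topCoeff (3 * m + 2) m := by
      rcases m with _ | _ | m
      · have h := topCoeff_two 3
        have h₁ := topCoeff_one 4
        have h₂ := topCoeff_one 2
        have h₃ := topCoeff_zero 2
        norm_num [Nat.choose] at h h₁ h₂ h₃ ⊢
        linarith
      · have h := topCoeff_add_topCoeff 6 0
        have h' := topCoeff_two 4
        norm_num [Nat.choose] at h h' ⊢
        linarith
      · have h := topCoeff_add_topCoeff (3 * m + 9) (m + 1)
        have h' := topCoeff_add_topCoeff (3 * m + 7) m
        rw [show 3 * (m + 1 + 1) + 4 = 3 * m + 9 + 1 by ring,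
          show 3 * (m + 1 + 1) + 2 = 3 * m + 7 + 1 by ring,
          show m + 1 + 1 + 2 = m + 1 + 3 by ring, show m + 1 + 1 + 1 = m + 3 by ring,
          show m + 1 + 1 = m + 2 by ring, h']
        refine h.trans ?_
        have p₁ : (2 * m + 7).choose (m + 4) =
            (2 * m + 6).choose (m + 3) + (2 * m + 6).choose (m + 4) :=
          Nat.choose_succ_succ _ _
        have p₂ : (2 * m + 7).choose (m + 2) =
            (2 * m + 6).choose (m + 1) + (2 * m + 6).choose (m + 2) :=
          Nat.choose_succ_succ _ _
        -- The symmetry of row 2m + 6 is what makes the two binomial differences agree.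
        have p₃ : (2 * m + 6).choose (m + 4) = (2 * m + 6).choose (m + 2) :=
          Nat.choose_symm_of_eq_add (by ring)
        rw [show 3 * m + 9 + 2 - (m + 1 + 3) = 2 * m + 7 by omega,
          show m + 1 + 3 = m + 4 by ring, show 3 * m + 9 - (m + 1 + 1) = 2 * m + 7 by omega,
          show 3 * m + 7 + 2 - (m + 3) = 2 * m + 6 by omega,
          show 3 * m + 7 - (m + 1) = 2 * m + 6 by omega, show m + 1 + 1 = m + 2 by ring,
          p₁, p₂, p₃]
        push_cast
        ring
    rw [show 3 * (m + 1) + 2 = 3 * m + 3 + 2 by ring]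
    rw [show 3 * m + 3 + 1 = 3 * m + 4 by ring, show m + 1 + 1 = m + 2 by ring] at e₁
    rw [show 3 * m + 2 + 2 = 3 * m + 4 by ring, show 3 * m + 2 + 1 = 3 * m + 3 by ring] at e₂
    rw [show m + 1 + 1 = m + 2 by ring]
    linarith

theorem topCoeff_nonneg {n d : ℕ} (h : 3 * d ≤ n + 1) : 0 ≤ topCoeff n d := by
  induction n using Nat.strong_induction_on generalizing d with
  | _ n ih =>
    rcases d with _ | d
    · rw [topCoeff_zero]
      norm_num
    · rcases Nat.lt_or_ge n (3 * d + 3) with hlt | hge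
      · rw [show n = 3 * d + 2 by omega, topCoeff_three_mul_add_two]
        norm_num
      · obtain ⟨n, rfl⟩ : ∃ e, n = e + 2 := ⟨n - 2, by omega⟩
        rw [topCoeff_add_two]
        exact add_nonneg (ih _ (by omega) (by omega)) (ih _ (by omega) (by omega))

/-- The three-step recursion lowers d but keeps k in its first term, so it preserves k ≤ d only off
the diagonal. -/
theorem coeff_differenceSeries_nonneg {n d k : ℕ} (h : 3 * d ≤ n + 1) (hk : k ≤ d) :
    0 ≤ coeff k ((1 - X) ^ d * differenceSeries n) := by
  induction d generalizing n k with
  | zero =>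
    obtain rfl : k = 0 := by omega
    exact topCoeff_nonneg h
  | succ d ih =>
    rcases hk.eq_or_lt with rfl | hlt
    · exact topCoeff_nonneg h
    · rcases Nat.lt_or_ge n 3 with h3 | h3
      · obtain rfl : d = 0 := by omega
        obtain rfl : k = 0 := by omega
        have := topCoeff_zero n
        rw [topCoeff, pow_zero, one_mul] at this
        simp only [zero_add, pow_one, sub_mul, one_mul, map_sub, this, coeff_zero_X_mul]
        norm_num
      · obtain ⟨n, rfl⟩ : ∃ e, n = e + 3 := ⟨n - 3, by omega⟩
        rw [differenceSeries_add_three, one_sub_X_pow_succ_mul_recursion, map_add]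
        refine add_nonneg (ih (by omega) (by omega)) ?_
        cases k with
        | zero => simp
        | succ k =>
          rw [coeff_succ_X_mul]
          exact ih (by omega) (by omega)

/-! ### The sums of the statement as coefficients. -/

theorem sum_path_eq_coeff {n d k : ℕ} (hk : k ≤ d) (hd : d ≤ n) :
    ∑ j ∈ Finset.Icc 0 k, (-1 : ℤ) ^ (k - j) * (Nat.choose (d - j) (k - j) : ℤ) *
      (Nat.choose (n - j + 1) j : ℤ) = coeff k ((1 - X) ^ d * fibSeries (n + 2)) := by
  rw [coeff_one_sub_X_pow_mul_fibSeries hk]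
  refine Finset.sum_congr rfl fun j hj => ?_
  rw [Finset.mem_Icc] at hj
  rw [show n - j + 1 = n + 1 - j by omega]

theorem sum_shifted_eq_coeff {n d k : ℕ} (hn : 1 ≤ n) (hk : k ≤ d) (hd : d ≤ n) :
    ∑ j ∈ Finset.Icc 2 k, (-1 : ℤ) ^ (k - j) * (Nat.choose (d - j) (k - j) : ℤ) *
      (Nat.choose (n - j + 1) (j - 2) : ℤ) =
      coeff k ((1 - X) ^ d * (geomTail ^ 2 * fibSeries n)) := by
  obtain ⟨n, rfl⟩ := Nat.exists_eq_add_of_le' hn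
  rw [coeff_one_sub_X_pow_mul_sq_mul_fibSeries hk]
  refine Finset.sum_congr rfl fun j hj => ?_
  rw [Finset.mem_Icc] at hj
  rw [show n + 1 - j + 1 = n - (j - 2) by omega]

theorem sum_cycle_eq_coeff {n d k : ℕ} (hn : 3 ≤ n) (hk : k ≤ d) :
    ∑ j ∈ Finset.Icc 2 k, (-1 : ℤ) ^ (k - j) * (Nat.choose (d - j) (k - j) : ℤ) *
      (Nat.choose (n - j - 1) (j - 2) : ℤ) =
      coeff k ((1 - X) ^ d * (geomTail ^ 2 * fibSeries (n - 2))) := by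
  obtain ⟨n, rfl⟩ := Nat.exists_eq_add_of_le' hn
  rw [show n + 3 - 2 = n + 1 by omega, coeff_one_sub_X_pow_mul_sq_mul_fibSeries hk]
  refine Finset.sum_congr rfl fun j hj => ?_
  rw [Finset.mem_Icc] at hj
  rw [show n + 3 - j - 1 = n - (j - 2) by omega]

/-- The factor `geomTail ^ 2` absorbs two factors `1 - X`, which accounts for the slack 6 = 3 · 2.
-/
theorem coeff_sq_mul_fibSeries_nonneg {i d : ℕ} (h : 3 * d ≤ i + 6) {k : ℕ} (hk : k ≤ d) :
    0 ≤ coeff k ((1 - X) ^ d * (geomTail ^ 2 * fibSeries i)) := by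
  rcases lt_or_ge k 2 with h2 | h2
  · rw [coeff_mul_sq_mul_of_lt h2]
  · obtain ⟨k, rfl⟩ := Nat.exists_eq_add_of_le' h2
    obtain ⟨d, rfl⟩ := Nat.exists_eq_add_of_le' (h2.trans hk)
    rw [coeff_one_sub_X_pow_mul_sq_mul]
    exact coeffNonneg_one_sub_X_pow_mul_fibSeries d (by omega) k

/-- After two factors are absorbed, the claim rests on F_(i+3) - F_(i+1) = y (F_(i+1) + F_i). It
deduces (1') from (1). -/
theorem coeff_sq_mul_fibSeries_le {i d : ℕ} (h : 3 * d ≤ i + 5) {k : ℕ} (hk : k ≤ d) :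
    coeff k ((1 - X) ^ d * (geomTail ^ 2 * fibSeries (i + 1))) ≤
      coeff k ((1 - X) ^ d * (geomTail ^ 2 * fibSeries (i + 3))) := by
  rcases lt_or_ge k 2 with h2 | h2
  · rw [coeff_mul_sq_mul_of_lt h2, coeff_mul_sq_mul_of_lt h2]
  · obtain ⟨k, rfl⟩ := Nat.exists_eq_add_of_le' h2
    obtain ⟨d, rfl⟩ := Nat.exists_eq_add_of_le' (h2.trans hk)
    rw [coeff_one_sub_X_pow_mul_sq_mul, coeff_one_sub_X_pow_mul_sq_mul, ← sub_nonneg, ← map_sub,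
      fibSeries_add_three]
    have hy := CoeffNonneg.geomTail
    have := (hy.mul (coeffNonneg_one_sub_X_pow_mul_fibSeries d (show 3 * d ≤ i + 1 by omega))).add
      (hy.mul (coeffNonneg_one_sub_X_pow_mul_fibSeries d (show 3 * d ≤ i by omega)))
    convert this k using 2
    ring

/-! ### Rounding. -/

theorem three_mul_ceil_sub_one_le {n : ℕ} (hn : 1 ≤ n) : 3 * ⌈((n : ℚ) - 1) / 3⌉₊ ≤ n + 1 := by
  have hn' : (1 : ℚ) ≤ n := by exact_mod_cast hn
  have h := Nat.ceil_lt_add_one (show (0 : ℚ) ≤ ((n : ℚ) - 1) / 3 by linarith)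
  have h' : ((3 * ⌈((n : ℚ) - 1) / 3⌉₊ : ℕ) : ℚ) < ((n + 2 : ℕ) : ℚ) := by
    push_cast
    linarith
  have := Nat.cast_lt.mp h'
  omega

theorem three_mul_ceil_add_two_le (n : ℕ) : 3 * ⌈((n : ℚ) + 2) / 3⌉₊ ≤ n + 4 := by
  have h := Nat.ceil_lt_add_one (show (0 : ℚ) ≤ ((n : ℚ) + 2) / 3 by positivity)
  have h' : ((3 * ⌈((n : ℚ) + 2) / 3⌉₊ : ℕ) : ℚ) < ((n + 5 : ℕ) : ℚ) := by
    push_cast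
    linarith
  have := Nat.cast_lt.mp h'
  omega

theorem le_three_mul_ceil_add_two (n : ℕ) : n + 2 ≤ 3 * ⌈((n : ℚ) + 2) / 3⌉₊ := by
  have h := Nat.le_ceil (((n : ℚ) + 2) / 3)
  have h' : ((n + 2 : ℕ) : ℚ) ≤ ((3 * ⌈((n : ℚ) + 2) / 3⌉₊ : ℕ) : ℚ) := by
    push_cast
    linarith
  exact Nat.cast_le.mp h'

theorem floor_eq_sub_ceil (n : ℕ) :
    ⌊(2 * (n : ℚ) + 1) / 3⌋₊ = n + 1 - ⌈((n : ℚ) + 2) / 3⌉₊ := by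
  have h₁ := three_mul_ceil_add_two_le n
  have h₂ := le_three_mul_ceil_add_two n
  have hf := Nat.floor_le (show (0 : ℚ) ≤ (2 * (n : ℚ) + 1) / 3 by positivity)
  have hl := Nat.lt_floor_add_one ((2 * (n : ℚ) + 1) / 3)
  have hf' : ((3 * ⌊(2 * (n : ℚ) + 1) / 3⌋₊ : ℕ) : ℚ) ≤ ((2 * n + 1 : ℕ) : ℚ) := by
    push_cast
    linarith
  have hl' : ((2 * n + 1 : ℕ) : ℚ) < ((3 * ⌊(2 * (n : ℚ) + 1) / 3⌋₊ + 3 : ℕ) : ℚ) := by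
    push_cast
    linarith
  have := Nat.cast_le.mp hf'
  have := Nat.cast_lt.mp hl'
  omega

theorem mainTheorem8 (n : ℕ) (hn : 3 ≤ n) :
    -- the three inequalities with the binomial coefficients `C(n - j + 1, j - 2)`
    (∀ k : ℕ, k ≤ ⌈((n : ℚ) - 1) / 3⌉₊ →
      ∑ j ∈ Finset.Icc 0 k, (-1 : ℤ) ^ (k - j) *
          (Nat.choose (⌈((n : ℚ) - 1) / 3⌉₊ - j) (k - j) : ℤ) *
          (Nat.choose (n - j + 1) j : ℤ) ≥
        ∑ j ∈ Finset.Icc 2 k, (-1 : ℤ) ^ (k - j) *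
          (Nat.choose (⌈((n : ℚ) - 1) / 3⌉₊ - j) (k - j) : ℤ) *
          (Nat.choose (n - j + 1) (j - 2) : ℤ)) ∧
    (∀ k : ℕ, 2 ≤ k → k ≤ ⌈((n : ℚ) + 2) / 3⌉₊ →
      ∑ j ∈ Finset.Icc 2 k, (-1 : ℤ) ^ (k - j) *
          (Nat.choose (⌈((n : ℚ) + 2) / 3⌉₊ - j) (k - j) : ℤ) *
          (Nat.choose (n - j + 1) (j - 2) : ℤ) ≥ 0) ∧
    (∀ k : ℕ, k ≤ ⌈((n : ℚ) + 2) / 3⌉₊ →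
      (Nat.choose (⌊(2 * (n : ℚ) + 1) / 3⌋₊ + k - 2) k : ℤ) -
        ∑ j ∈ Finset.Icc 0 k, (-1 : ℤ) ^ (k - j) *
          (Nat.choose (⌈((n : ℚ) + 2) / 3⌉₊ - j) (k - j) : ℤ) *
          (Nat.choose (n - j + 1) j : ℤ) ≥
        ∑ j ∈ Finset.Icc 2 k, (-1 : ℤ) ^ (k - j) *
          (Nat.choose (⌈((n : ℚ) + 2) / 3⌉₊ - j) (k - j) : ℤ) *
          (Nat.choose (n - j + 1) (j - 2) : ℤ)) ∧
    -- the three inequalities with the binomial coefficients `C(n - j - 1, j - 2)`,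
    -- which count the squarefree monomials of degree `j` in `J_{n,2} / I_{n,2}`
    (∀ k : ℕ, k ≤ ⌈((n : ℚ) - 1) / 3⌉₊ →
      ∑ j ∈ Finset.Icc 0 k, (-1 : ℤ) ^ (k - j) *
          (Nat.choose (⌈((n : ℚ) - 1) / 3⌉₊ - j) (k - j) : ℤ) *
          (Nat.choose (n - j + 1) j : ℤ) ≥
        ∑ j ∈ Finset.Icc 2 k, (-1 : ℤ) ^ (k - j) *
          (Nat.choose (⌈((n : ℚ) - 1) / 3⌉₊ - j) (k - j) : ℤ) *
          (Nat.choose (n - j - 1) (j - 2) : ℤ)) ∧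
    (∀ k : ℕ, 2 ≤ k → k ≤ ⌈((n : ℚ) + 2) / 3⌉₊ →
      ∑ j ∈ Finset.Icc 2 k, (-1 : ℤ) ^ (k - j) *
          (Nat.choose (⌈((n : ℚ) + 2) / 3⌉₊ - j) (k - j) : ℤ) *
          (Nat.choose (n - j - 1) (j - 2) : ℤ) ≥ 0) ∧
    (∀ k : ℕ, k ≤ ⌈((n : ℚ) + 2) / 3⌉₊ →
      (Nat.choose (⌊(2 * (n : ℚ) + 1) / 3⌋₊ + k - 2) k : ℤ) -
        ∑ j ∈ Finset.Icc 0 k, (-1 : ℤ) ^ (k - j) *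
          (Nat.choose (⌈((n : ℚ) + 2) / 3⌉₊ - j) (k - j) : ℤ) *
          (Nat.choose (n - j + 1) j : ℤ) ≥
        - ∑ j ∈ Finset.Icc 2 k, (-1 : ℤ) ^ (k - j) *
          (Nat.choose (⌈((n : ℚ) + 2) / 3⌉₊ - j) (k - j) : ℤ) *
          (Nat.choose (n - j - 1) (j - 2) : ℤ)) := by
  have hc := three_mul_ceil_sub_one_le (show 1 ≤ n by omega)
  have hd := three_mul_ceil_add_two_le n
  have hd' := le_three_mul_ceil_add_two n
  have hfl := floor_eq_sub_ceil n
  rw [hfl]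
  generalize ⌈((n : ℚ) - 1) / 3⌉₊ = c at hc ⊢
  generalize ⌈((n : ℚ) + 2) / 3⌉₊ = d at hd hd' ⊢
  have h1 : ∀ k ≤ c, coeff k ((1 - X) ^ c * (geomTail ^ 2 * fibSeries n)) ≤
      coeff k ((1 - X) ^ c * fibSeries (n + 2)) := fun k hk => by
    have := coeff_differenceSeries_nonneg hc hk
    rw [differenceSeries, mul_sub, map_sub] at this
    linarith
  have h3 : ∀ k, coeff k ((1 - X) ^ d * (geomTail ^ 2 * fibSeries n)) ≤
      ((n + 1 - d + k - 2).choose k : ℤ) - coeff k ((1 - X) ^ d * fibSeries (n + 2)) :=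
    fun k => by
      have := coeffNonneg_one_sub_X_pow_mul_complementSeries (show 2 ≤ n by omega) hd k
      rw [complementSeries, mul_sub, mul_sub, map_sub, map_sub,
        coeff_one_sub_X_pow_mul_one_add_geomTail_pow (show d < n by omega)] at this
      -- No truncation occurs, as d < n gives n + 1 - d ≥ 2.
      rw [show n + 1 - d + k - 2 = n - d - 1 + k by omega]
      linarith
  refine ⟨fun k hk => ?_, fun k _ hk => ?_, fun k hk => ?_, fun k hk => ?_, fun k _ hk => ?_,
    fun k hk => ?_⟩
  · rw [sum_path_eq_coeff hk (by omega), sum_shifted_eq_coeff (by omega) hk (by omega)]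
    exact h1 k hk
  · rw [sum_shifted_eq_coeff (by omega) hk (by omega)]
    exact coeff_sq_mul_fibSeries_nonneg (by omega) hk
  · rw [sum_path_eq_coeff hk (by omega), sum_shifted_eq_coeff (by omega) hk (by omega)]
    exact h3 k
  · rw [sum_path_eq_coeff hk (by omega), sum_cycle_eq_coeff hn hk]
    refine le_trans ?_ (h1 k hk)
    obtain ⟨i, rfl⟩ := Nat.exists_eq_add_of_le' hn
    exact coeff_sq_mul_fibSeries_le (by omega) hk
  · rw [sum_cycle_eq_coeff hn hk]
    exact coeff_sq_mul_fibSeries_nonneg (by omega) hk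
  · rw [sum_path_eq_coeff hk (by omega), sum_cycle_eq_coeff hn hk]
    have p₁ : 0 ≤ coeff k ((1 - X) ^ d * (geomTail ^ 2 * fibSeries n)) :=
      coeff_sq_mul_fibSeries_nonneg (by omega) hk
    have p₂ : 0 ≤ coeff k ((1 - X) ^ d * (geomTail ^ 2 * fibSeries (n - 2))) :=
      coeff_sq_mul_fibSeries_nonneg (by omega) hk
    -- By (3) the left side is at least the shifted sum `p₁`, hence nonnegative, while the right
    -- side is nonpositive by `p₂`.
    have := h3 k
    linarith
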